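/- For even $n\ge 2$ let $K_{n,n}$ be the complete bipartite graph on $\{u_1,\dots,u_n\}\cup\{v_1,\dots,v_n\}$ with weight $w_{ij}$ on the edge $u_iv_j$. Belief propagation (BP) for maximum-weight matching uses messages $\vec m^{\,t}_{ij}(r)$ (from $u_i$ to $v_j$) and $\overleftarrow m^{\,t}_{ji}(r)$ (from $v_j$ to $u_i$), $1\le r\le n$, with $$\vec m^{\,0}_{ij}(r)=\begin{cases}w_{ij}& r=i\\ 0& r\ne i,\end{cases}\qquad \overleftarrow m^{\,0}_{ji}(r)=\begin{cases}w_{ij}& r=j\\ 0& r\neq j,\end{cases}$$ and, for $t\ge 1$, $$\vec m^{\,t}_{ij}(r)=\begin{cases}w_{ij}+\sum_{k\ne j}\overleftarrow m^{\,t-1}_{ki}(j)& r=i\\ \max_{q\ne j}\bigl[w_{iq}+\sum_{k\ne j}\overleftarrow m^{\,t-1}_{ki}(q)\bigr]& r\ne i,\end{cases}\qquad \overleftarrow m^{\,t}_{ji}(r)=\begin{cases}w_{ij}+\sum_{k\ne i}\vec m^{\,t-1}_{kj}(i)& r=j\\ \max_{q\ne i}\bigl[w_{qj}+\sum_{k\ne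 i}\vec m^{\,t-1}_{kj}(q)\bigr]& r\ne j.\end{cases}$$ The estimate in iteration $t$ joins each $u_i$ to a $v_j$ for which $j$ maximizes the belief $b^t_{u_i}(r)=w_{ir}+\sum_k\overleftarrow m^{\,t}_{ki}(r)$ over $r$. Let $\tau\in\{0,1,2,\dots\}\cup\{\infty\}$ be the number of iterations that BP needs to converge, i.e. the smallest $T$ such that in all iterations $s\ge T$ the estimate is the maximum-weight matching (ties in the maximization being resolved in favour of this). There are absolute constants $a,c>0$ such that for every real $\phi\ge 26$ and every even $n\ge2$ there are probability distributions on $[0,1]$, one for each edge of $K_{n,n}$, with densities bounded by $\phi$, such that, if the edge weights are drawn independently from these distributions, then $$\Pr(\tau\ge t)\ \ge\ a\,\frac{n\phi}{t}\qquad\text{for all integers } t\ge \frac{n\phi}{c},$$ and consequently $\mathbb E[\tau]=\infty$. -/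

import Mathlib

open MeasureTheory
open scoped BigOperators

namespace BPMatching

noncomputable section

/-- An edge `(u_i, v_j)` of the complete bipartite graph `K_{n,n}` is the pair `(i, j)`. -/
abbrev Edge (n : ℕ) : Type := Fin n × Fin n

/-- A matching of `K_{n,n}`: a set of edges no two of which share an endpoint
(it need not be perfect). -/
def IsMatching {n : ℕ} (M : Finset (Edge n)) : Prop :=
  ∀ e ∈ M, ∀ f ∈ M, (e.1 = f.1 ∨ e.2 = f.2) → e = f

/-- The weight of a set of edges. -/
def weight {n : ℕ} (w : Edge n → ℝ) (M : Finset (Edge n)) : ℝ := ∑ e ∈ M, w e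

/-- `M` is a maximum-weight matching of `K_{n,n}` with edge weights `w`. -/
def IsMaxWeightMatching {n : ℕ} (w : Edge n → ℝ) (M : Finset (Edge n)) : Prop :=
  IsMatching M ∧ ∀ N : Finset (Edge n), IsMatching N → weight w N ≤ weight w M

/-- The messages of max-product belief propagation (in logarithmic form) for maximum-weight
matching. `(messages w t).1 i j r` is the entry `r` of the message that `u_i` sends to `v_j` in
iteration `t`, and `(messages w t).2 j i r` is the entry `r` of the message that `v_j` sends to
`u_i`. For `2 ≤ n` the suprema are maxima over nonempty finite sets. -/
def messages {n : ℕ} (w : Edge n → ℝ) :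
    ℕ → (Fin n → Fin n → Fin n → ℝ) × (Fin n → Fin n → Fin n → ℝ)
  | 0 =>
    (fun i j r => if r = i then w (i, j) else 0,
     fun j i r => if r = j then w (i, j) else 0)
  | t + 1 =>
    (fun i j r =>
      if r = i then w (i, j) + ∑ k ∈ Finset.univ.erase j, (messages w t).2 k i j
      else ⨆ q : {q : Fin n // q ≠ j},
        (w (i, q.1) + ∑ k ∈ Finset.univ.erase j, (messages w t).2 k i q.1),
     fun j i r =>
      if r = j then w (i, j) + ∑ k ∈ Finset.univ.erase i, (messages w t).1 k j i
      else ⨆ q : {q : Fin n // q ≠ i},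
        (w (q.1, j) + ∑ k ∈ Finset.univ.erase i, (messages w t).1 k j q.1))

/-- The belief of `u_i` in iteration `t` that it should be matched to `v_r`. -/
def belief {n : ℕ} (w : Edge n → ℝ) (t : ℕ) (i r : Fin n) : ℝ :=
  w (i, r) + ∑ k, (messages w t).2 k i r

/-- `M` is an estimate of belief propagation in iteration `t`: it joins every `u_i` to some `v_j`
whose index `j` maximizes the belief of `u_i`. It is the only one unless there are ties. -/
def IsEstimate {n : ℕ} (w : Edge n → ℝ) (t : ℕ) (M : Finset (Edge n)) : Prop :=
  ∃ f : Fin n → Fin n, (∀ i r, belief w t i r ≤ belief w t i (f i)) ∧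
    M = Finset.univ.image (fun i => (i, f i))

/-- From iteration `T` on, the estimate is the maximum-weight matching. (A tie is resolved in
favour of correctness, so that a lower bound on the time until this happens holds for every
tie-breaking rule.) -/
def ConvergedBy {n : ℕ} (w : Edge n → ℝ) (T : ℕ) : Prop :=
  ∃ M : Finset (Edge n), IsMaxWeightMatching w M ∧ ∀ s : ℕ, T ≤ s → IsEstimate w s M

/-- The number of iterations that belief propagation needs to converge to the maximum-weight
matching; it is `⊤` if this never happens. -/
def iterations {n : ℕ} (w : Edge n → ℝ) : ℕ∞ :=
  ⨅ (T : ℕ) (_ : ConvergedBy w T), (T : ℕ∞)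

/-- `D` is a probability distribution on `[0,1]` with a density that is bounded by `φ`. -/
def HasBoundedDensity (φ : ℝ) (D : Measure ℝ) : Prop :=
  IsProbabilityMeasure D ∧ ∃ f : ℝ → ℝ, Measurable f ∧ (∀ x, 0 ≤ f x ∧ f x ≤ φ) ∧
    (∀ x, x ∉ Set.Icc (0 : ℝ) 1 → f x = 0) ∧
    D = volume.withDensity (fun x => ENNReal.ofReal (f x))

end

end BPMatching

namespace BPMatching

noncomputable section

/-! A message takes only two values, so up to an additive constant it is one number per directed
edge, and BP becomes the recursion `x_{ij} ← w_{ij} - max_{q ≠ j} y_{qi}`; the belief of `u_i` ranks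
the columns `r` by `y_{ri}` (`messages_eq_reduced`, `belief_le_belief_iff`).

Split the graph into `n/2` copies of `K_{2,2}`, with weights near 7/10 in one column of each block,
near 9/10 in the other, and near 0 between blocks. As long as the maxima inside a block are attained
inside it, messages run around its 4-cycle, and every four iterations they shift by ± the gap `δ`,
the difference of the weights of its two perfect matchings (`blockState_four_mul`). While `k|δ| ≤
1/20`, both rows prefer the heavier column in iteration `4k`, and the estimate is not a matching.
Messages between blocks stay too small to interfere: an optimal dual solution bounds messages on
matched edges from below, hence those on unmatched edges from above (`crossBound_unmatched`).

A gap is at most `1/(20t)` with probability of order `φ/t`. The gaps are independent, so some block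
is that balanced with probability of order `nφ/t`; summing over `t` gives a divergent harmonic
series. -/

/-! ### Reduction to one number per directed edge -/

/-- The reduced messages: half the difference of the two distinct entries of a message, plus half
the weight of the edge. -/
def reduced {n : ℕ} (w : Edge n → ℝ) : ℕ → (Fin n → Fin n → ℝ) × (Fin n → Fin n → ℝ)
  | 0 => (fun i j => w (i, j), fun j i => w (i, j))
  | t + 1 =>
    (fun i j => w (i, j) - ⨆ q : {q : Fin n // q ≠ j}, (reduced w t).2 q.1 i,
     fun j i => w (i, j) - ⨆ q : {q : Fin n // q ≠ i}, (reduced w t).1 q.1 j)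

variable {n : ℕ}

theorem sum_erase_message (L X : Fin n → ℝ) (j q : Fin n) :
    ∑ k ∈ Finset.univ.erase j, (L k + if q = k then X k else 0) =
      ∑ k ∈ Finset.univ.erase j, L k + if q = j then 0 else X q := by
  rw [Finset.sum_add_distrib, Finset.sum_ite_eq]
  by_cases h : q = j <;> simp [h]

theorem ciSup_ne_eq_mul_add (hn : 2 ≤ n) (j : Fin n) (Y : Fin n → ℝ) (c : ℝ)
    (F : Fin n → ℝ) (hF : ∀ q, q ≠ j → F q = 2 * Y q + c) :
    (⨆ q : {q : Fin n // q ≠ j}, F q.1) = 2 * (⨆ q : {q : Fin n // q ≠ j}, Y q.1) + c := by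
  have : Nontrivial (Fin n) := Fin.nontrivial_iff_two_le.mpr hn
  obtain ⟨q₀, hq₀⟩ := exists_ne j
  have : Nonempty {q : Fin n // q ≠ j} := ⟨⟨q₀, hq₀⟩⟩
  have h : ∀ q : {q : Fin n // q ≠ j}, F q.1 = 2 * Y q.1 + c := fun q => hF q.1 q.2
  simp_rw [h]
  rw [← ciSup_add (Set.finite_range _).bddAbove, Real.mul_iSup_of_nonneg (by norm_num)]

theorem messages_eq_reduced (hn : 2 ≤ n) (w : Edge n → ℝ) (t : ℕ) :
    (∃ L : Fin n → Fin n → ℝ, ∀ i j r, (messages w t).1 i j r =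
      L i j + if r = i then 2 * (reduced w t).1 i j - w (i, j) else 0) ∧
    (∃ L : Fin n → Fin n → ℝ, ∀ j i r, (messages w t).2 j i r =
      L j i + if r = j then 2 * (reduced w t).2 j i - w (i, j) else 0) := by
  induction t with
  | zero =>
    refine ⟨⟨fun _ _ => 0, fun i j r => ?_⟩, ⟨fun _ _ => 0, fun i j r => ?_⟩⟩ <;>
    · simp only [messages, reduced]
      split_ifs <;> ring
  | succ t ih =>
    obtain ⟨⟨L, hL⟩, ⟨K, hK⟩⟩ := ih
    constructor
    · refine ⟨fun i j => 2 * (⨆ q : {q : Fin n // q ≠ j}, (reduced w t).2 q.1 i) +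
        ∑ k ∈ Finset.univ.erase j, K k i, fun i j r => ?_⟩
      simp only [messages, reduced, hK]
      rw [ciSup_ne_eq_mul_add hn j (fun q => (reduced w t).2 q i)
        (∑ k ∈ Finset.univ.erase j, K k i) (fun q => w (i, q) + ∑ k ∈ Finset.univ.erase j,
          (K k i + if q = k then 2 * (reduced w t).2 k i - w (i, k) else 0))]
      · split_ifs
        · rw [sum_erase_message (fun k => K k i), if_pos rfl]; ring
        · ring
      · intro q hq
        rw [sum_erase_message (fun k => K k i), if_neg hq]; ring
    · refine ⟨fun j i => 2 * (⨆ q : {q : Fin n // q ≠ i}, (reduced w t).1 q.1 j) +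
        ∑ k ∈ Finset.univ.erase i, L k j, fun j i r => ?_⟩
      simp only [messages, reduced, hL]
      rw [ciSup_ne_eq_mul_add hn i (fun q => (reduced w t).1 q j)
        (∑ k ∈ Finset.univ.erase i, L k j) (fun q => w (q, j) + ∑ k ∈ Finset.univ.erase i,
          (L k j + if q = k then 2 * (reduced w t).1 k j - w (k, j) else 0))]
      · split_ifs
        · rw [sum_erase_message (fun k => L k j), if_pos rfl]; ring
        · ring
      · intro q hq
        rw [sum_erase_message (fun k => L k j), if_neg hq]; ring

/-- The bonus `2y - w` in the message from `v_r` cancels the weight `w (i, r)`, so the belief is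
`2y` plus a term independent of `r`. -/
theorem belief_le_belief_iff (hn : 2 ≤ n) (w : Edge n → ℝ) (t : ℕ) (i r s : Fin n) :
    belief w t i r ≤ belief w t i s ↔ (reduced w t).2 r i ≤ (reduced w t).2 s i := by
  obtain ⟨-, L, hL⟩ := messages_eq_reduced hn w t
  simp only [belief, hL, Finset.sum_add_distrib, Finset.sum_ite_eq, Finset.mem_univ, if_true]
  constructor <;> intro h <;> linarith

theorem le_ciSup_ne (Y : Fin n → ℝ) {j q : Fin n} (h : q ≠ j) :
    Y q ≤ ⨆ q : {q : Fin n // q ≠ j}, Y q.1 :=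
  le_ciSup (f := fun q : {q : Fin n // q ≠ j} => Y q.1) (Set.finite_range _).bddAbove ⟨q, h⟩

theorem ciSup_ne_le (hn : 2 ≤ n) (Y : Fin n → ℝ) {j : Fin n} {c : ℝ} (h : ∀ q, q ≠ j → Y q ≤ c) :
    (⨆ q : {q : Fin n // q ≠ j}, Y q.1) ≤ c := by
  have : Nontrivial (Fin n) := Fin.nontrivial_iff_two_le.mpr hn
  obtain ⟨q₀, hq₀⟩ := exists_ne j
  have : Nonempty {q : Fin n // q ≠ j} := ⟨⟨q₀, hq₀⟩⟩
  exact ciSup_le fun q => h q.1 q.2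

/-! ### Message bounds from a tight dual solution -/

/-- The reduced messages along the edges of the perfect matching `π`, normalized by the dual
solution `(a, b)`, are at least `m` in iteration `t`. -/
def MatchedLowerBound (w : Edge n → ℝ) (a b : Fin n → ℝ) (π : Equiv.Perm (Fin n)) (m : ℝ)
    (t : ℕ) : Prop :=
  ∀ i, m ≤ (reduced w t).1 i (π i) - b (π i) ∧ m ≤ (reduced w t).2 (π i) i - a i

section Dual

variable {w : Edge n → ℝ} {a b : Fin n → ℝ} {π : Equiv.Perm (Fin n)} {m : ℝ} {t : ℕ}

theorem MatchedLowerBound.unmatched_le (h : MatchedLowerBound w a b π m t) {i j : Fin n}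
    (hij : j ≠ π i) :
    (reduced w (t + 1)).1 i j ≤ w (i, j) - a i - m ∧
      (reduced w (t + 1)).2 j i ≤ w (i, j) - b j - m := by
  constructor
  · have h1 := le_ciSup_ne (fun q => (reduced w t).2 q i) hij.symm
    have h2 := (h i).2
    simp only [reduced]
    linarith
  · have h1 := le_ciSup_ne (fun q => (reduced w t).1 q j) (j := i) (q := π.symm j)
      (fun h => hij (by rw [← h, Equiv.apply_symm_apply]))
    have h2 := (h (π.symm j)).1
    rw [Equiv.apply_symm_apply] at h2
    simp only [reduced]
    linarith

/-- A large message on a matched edge enters the maximum for each unmatched edge at the same vertex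
and makes that message small one iteration later. Dual feasibility and tightness on `π` turn this
back into the same lower bound after one more iteration. -/
theorem MatchedLowerBound.add_two (hn : 2 ≤ n) (hw : ∀ i j, w (i, j) ≤ a i + b j)
    (hπ : ∀ i, w (i, π i) = a i + b (π i)) (h : MatchedLowerBound w a b π m t) :
    MatchedLowerBound w a b π m (t + 2) := by
  intro i
  constructor
  · have : (reduced w (t + 2)).1 i (π i) =
        w (i, π i) - ⨆ q : {q : Fin n // q ≠ π i}, (reduced w (t + 1)).2 q.1 i := rfl
    have h1 : (⨆ q : {q : Fin n // q ≠ π i}, (reduced w (t + 1)).2 q.1 i) ≤ a i - m :=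
      ciSup_ne_le hn (fun q => (reduced w (t + 1)).2 q i) fun q hq => by
        have := (h.unmatched_le hq).2
        have := hw i q
        linarith
    rw [this, hπ]
    linarith
  · have : (reduced w (t + 2)).2 (π i) i =
        w (i, π i) - ⨆ q : {q : Fin n // q ≠ i}, (reduced w (t + 1)).1 q.1 (π i) := rfl
    have h1 : (⨆ q : {q : Fin n // q ≠ i}, (reduced w (t + 1)).1 q.1 (π i)) ≤ b (π i) - m :=
      ciSup_ne_le hn (fun q => (reduced w (t + 1)).1 q (π i)) fun q hq => by
        have := (h.unmatched_le (i := q) (j := π i) (fun h => hq (π.injective h).symm)).1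
        have := hw q (π i)
        linarith
    rw [this, hπ]
    linarith

theorem matchedLowerBound_even (hn : 2 ≤ n) {α : ℝ} (hw : ∀ i j, w (i, j) ≤ a i + b j)
    (hπ : ∀ i, w (i, π i) = a i + b (π i)) (ha : ∀ i, α ≤ a i) (hb : ∀ j, α ≤ b j) (t : ℕ) :
    MatchedLowerBound w a b π α (2 * t) := by
  induction t with
  | zero =>
    intro i
    simp only [reduced, hπ]
    constructor <;> linarith [ha i, hb (π i)]
  | succ t ih => exact ih.add_two hn hw hπ

theorem matchedLowerBound_odd (hn : 2 ≤ n) {β : ℝ} (hw : ∀ i j, w (i, j) ≤ a i + b j)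
    (hπ : ∀ i, w (i, π i) = a i + b (π i)) (ha : ∀ i, a i ≤ β) (hb : ∀ j, b j ≤ β) (t : ℕ) :
    MatchedLowerBound w a b π (-β) (2 * t + 1) := by
  induction t with
  | zero =>
    intro i
    simp only [reduced, hπ]
    have h1 := ciSup_ne_le hn (fun q => w (i, q)) (j := π i) (c := a i + β)
      fun q _ => by linarith [hw i q, hb q]
    have h2 := ciSup_ne_le hn (fun q => w (q, π i)) (j := i) (c := b (π i) + β)
      fun q _ => by linarith [hw q (π i), ha q]
    constructor <;> linarith
  | succ t ih => exact ih.add_two hn hw hπ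

end Dual

/-- A bound on the reduced messages on edges between different blocks. -/
def crossBound (ε : ℝ) (t : ℕ) : ℝ := if Even t then 1 / 5 + 2 * ε else ε - 7 / 10

/-- With duals in `[7/20, 11/20 + ε]`, the matched bound is 7/20 at even times and `-(11/20 + ε)` at
odd times. Subtracting it and a dual of at least 7/20 from a weight of at most `ε` gives `ε - 7/10`
and `1/5 + 2ε` one iteration later. -/
theorem crossBound_unmatched (hn : 2 ≤ n) {w : Edge n → ℝ} {a b : Fin n → ℝ}
    {π : Equiv.Perm (Fin n)} {ε : ℝ} (hε : 0 ≤ ε)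
    (hw : ∀ i j, w (i, j) ≤ a i + b j) (hπ : ∀ i, w (i, π i) = a i + b (π i))
    (ha : ∀ i, 7 / 20 ≤ a i ∧ a i ≤ 11 / 20 + ε) (hb : ∀ j, 7 / 20 ≤ b j ∧ b j ≤ 11 / 20 + ε)
    {i j : Fin n} (hij : j ≠ π i) (hwij : w (i, j) ≤ ε) (t : ℕ) :
    (reduced w t).1 i j ≤ crossBound ε t ∧ (reduced w t).2 j i ≤ crossBound ε t := by
  rcases t with _ | t
  · simp only [reduced, crossBound, Even.zero, if_true]
    constructor <;> linarith
  rcases Nat.even_or_odd' t with ⟨k, rfl | rfl⟩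
  · have h := (matchedLowerBound_even hn hw hπ (fun i => (ha i).1) (fun j => (hb j).1)
      k).unmatched_le hij
    have : ¬ Even (2 * k + 1) := by simp [parity_simps]
    rw [crossBound, if_neg this]
    constructor <;> linarith [h.1, h.2, (ha i).1, (hb j).1]
  · have h := (matchedLowerBound_odd hn hw hπ (fun i => (ha i).2) (fun j => (hb j).2)
      k).unmatched_le hij
    have : Even (2 * k + 1 + 1) := by simp [parity_simps]
    rw [crossBound, if_pos this]
    constructor <;> linarith [h.1, h.2, (ha i).1, (hb j).1]

/-! ### Dynamics inside a block -/

/-- The reduced messages inside the block with rows `i₁, i₂` and columns `j₁, j₂`. -/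
def BlockState (w : Edge n → ℝ) (i₁ i₂ j₁ j₂ : Fin n) (t : ℕ)
    (x₁₁ x₁₂ x₂₁ x₂₂ y₁₁ y₁₂ y₂₁ y₂₂ : ℝ) : Prop :=
  ((reduced w t).1 i₁ j₁ = x₁₁ ∧ (reduced w t).1 i₁ j₂ = x₁₂ ∧
    (reduced w t).1 i₂ j₁ = x₂₁ ∧ (reduced w t).1 i₂ j₂ = x₂₂) ∧
  ((reduced w t).2 j₁ i₁ = y₁₁ ∧ (reduced w t).2 j₂ i₁ = y₁₂ ∧
    (reduced w t).2 j₁ i₂ = y₂₁ ∧ (reduced w t).2 j₂ i₂ = y₂₂)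

theorem ciSup_ne_eq (hn : 2 ≤ n) {Y : Fin n → ℝ} {j j' : Fin n} {c y : ℝ} (hj : j' ≠ j)
    (hy : Y j' = y) (hc : c ≤ y) (h : ∀ q, q ≠ j → q ≠ j' → Y q ≤ c) :
    (⨆ q : {q : Fin n // q ≠ j}, Y q.1) = y := by
  refine le_antisymm (ciSup_ne_le hn Y fun q hq => ?_) (hy ▸ le_ciSup_ne Y hj)
  by_cases hq' : q = j'
  · rw [hq', hy]
  · exact (h q hq hq').trans hc

section Block

variable {w : Edge n → ℝ} {i₁ i₂ j₁ j₂ : Fin n} {ε : ℝ}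

/-- The common threshold `c` separates outside messages from inside ones, so each maximum is
attained at the only other vertex of the block on that side. -/
theorem BlockState.succ (hn : 2 ≤ n) (hi : i₁ ≠ i₂) (hj : j₁ ≠ j₂) {c : ℝ} {t : ℕ}
    {x₁₁ x₁₂ x₂₁ x₂₂ y₁₁ y₁₂ y₂₁ y₂₂ : ℝ}
    (h : BlockState w i₁ i₂ j₁ j₂ t x₁₁ x₁₂ x₂₁ x₂₂ y₁₁ y₁₂ y₂₁ y₂₂)
    (hX : ∀ k j, k ≠ i₁ → k ≠ i₂ → (j = j₁ ∨ j = j₂) → (reduced w t).1 k j ≤ c)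
    (hY : ∀ k i, k ≠ j₁ → k ≠ j₂ → (i = i₁ ∨ i = i₂) → (reduced w t).2 k i ≤ c)
    (hx : c ≤ x₁₁ ∧ c ≤ x₁₂ ∧ c ≤ x₂₁ ∧ c ≤ x₂₂) (hy : c ≤ y₁₁ ∧ c ≤ y₁₂ ∧ c ≤ y₂₁ ∧ c ≤ y₂₂) :
    BlockState w i₁ i₂ j₁ j₂ (t + 1) (w (i₁, j₁) - y₁₂) (w (i₁, j₂) - y₁₁) (w (i₂, j₁) - y₂₂)
      (w (i₂, j₂) - y₂₁) (w (i₁, j₁) - x₂₁) (w (i₁, j₂) - x₂₂) (w (i₂, j₁) - x₁₁)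
      (w (i₂, j₂) - x₁₂) := by
  obtain ⟨⟨h1, h2, h3, h4⟩, ⟨h5, h6, h7, h8⟩⟩ := h
  obtain ⟨a1, a2, a3, a4⟩ := hx
  obtain ⟨a5, a6, a7, a8⟩ := hy
  simp only [BlockState, reduced]
  refine ⟨⟨?_, ?_, ?_, ?_⟩, ⟨?_, ?_, ?_, ?_⟩⟩ <;> congr 1
  · exact ciSup_ne_eq hn (Y := fun q => (reduced w t).2 q i₁) hj.symm h6 a6
      fun q h h' => hY q _ h h' (.inl rfl)
  · exact ciSup_ne_eq hn (Y := fun q => (reduced w t).2 q i₁) hj h5 a5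
      fun q h h' => hY q _ h' h (.inl rfl)
  · exact ciSup_ne_eq hn (Y := fun q => (reduced w t).2 q i₂) hj.symm h8 a8
      fun q h h' => hY q _ h h' (.inr rfl)
  · exact ciSup_ne_eq hn (Y := fun q => (reduced w t).2 q i₂) hj h7 a7
      fun q h h' => hY q _ h' h (.inr rfl)
  · exact ciSup_ne_eq hn (Y := fun q => (reduced w t).1 q j₁) hi.symm h3 a3
      fun q h h' => hX q _ h h' (.inl rfl)
  · exact ciSup_ne_eq hn (Y := fun q => (reduced w t).1 q j₂) hi.symm h4 a4
      fun q h h' => hX q _ h h' (.inr rfl)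
  · exact ciSup_ne_eq hn (Y := fun q => (reduced w t).1 q j₁) hi h1 a1
      fun q h h' => hX q _ h' h (.inl rfl)
  · exact ciSup_ne_eq hn (Y := fun q => (reduced w t).1 q j₂) hi h2 a2
      fun q h h' => hX q _ h' h (.inr rfl)

/-- The excess of the diagonal of a block over its antidiagonal. -/
def blockGap (w : Edge n → ℝ) (i₁ i₂ j₁ j₂ : Fin n) : ℝ :=
  w (i₁, j₁) + w (i₂, j₂) - w (i₁, j₂) - w (i₂, j₁)

/-- Four substitutions lead once around the 4-cycle and collect its weights with alternating signs.
The bound on `k|δ|` keeps all inside messages above `crossBound` at each of the four steps. -/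
theorem blockState_four_mul (hn : 2 ≤ n) (hi : i₁ ≠ i₂) (hj : j₁ ≠ j₂) (hε : 0 ≤ ε)
    (hε' : ε ≤ 1 / 26)
    (hX : ∀ t k j, k ≠ i₁ → k ≠ i₂ → (j = j₁ ∨ j = j₂) → (reduced w t).1 k j ≤ crossBound ε t)
    (hY : ∀ t k i, k ≠ j₁ → k ≠ j₂ → (i = i₁ ∨ i = i₂) → (reduced w t).2 k i ≤ crossBound ε t)
    (h₁₁ : w (i₁, j₁) ∈ Set.Icc (7 / 10) (7 / 10 + ε))
    (h₂₁ : w (i₂, j₁) ∈ Set.Icc (7 / 10) (7 / 10 + ε))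
    (h₁₂ : w (i₁, j₂) ∈ Set.Icc (9 / 10) (9 / 10 + ε))
    (h₂₂ : w (i₂, j₂) ∈ Set.Icc (9 / 10) (9 / 10 + ε)) (k : ℕ)
    (hk : (k : ℝ) * |blockGap w i₁ i₂ j₁ j₂| ≤ 1 / 20) :
    BlockState w i₁ i₂ j₁ j₂ (4 * k)
      (w (i₁, j₁) + k * blockGap w i₁ i₂ j₁ j₂) (w (i₁, j₂) - k * blockGap w i₁ i₂ j₁ j₂)
      (w (i₂, j₁) - k * blockGap w i₁ i₂ j₁ j₂) (w (i₂, j₂) + k * blockGap w i₁ i₂ j₁ j₂)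
      (w (i₁, j₁) + k * blockGap w i₁ i₂ j₁ j₂) (w (i₁, j₂) - k * blockGap w i₁ i₂ j₁ j₂)
      (w (i₂, j₁) - k * blockGap w i₁ i₂ j₁ j₂) (w (i₂, j₂) + k * blockGap w i₁ i₂ j₁ j₂) := by
  induction k with
  | zero => simp [BlockState, reduced]
  | succ k ih =>
    set δ := blockGap w i₁ i₂ j₁ j₂ with hδ
    have hk' : (k : ℝ) * |δ| ≤ 1 / 20 := by
      refine le_trans ?_ hk
      gcongr
      simp
    have h0 := ih hk'
    have hb : |(k : ℝ) * δ| ≤ 1 / 20 := by rwa [abs_mul, Nat.abs_cast]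
    have hgap : δ = w (i₁, j₁) + w (i₂, j₂) - w (i₁, j₂) - w (i₂, j₁) := rfl
    obtain ⟨b1, b2⟩ := abs_le.mp hb
    obtain ⟨p1, p2⟩ := h₁₁
    obtain ⟨q1, q2⟩ := h₁₂
    obtain ⟨r1, r2⟩ := h₂₁
    obtain ⟨s1, s2⟩ := h₂₂
    have e0 : crossBound ε (4 * k) = 1 / 5 + 2 * ε := if_pos (by simp [parity_simps])
    have e1 : crossBound ε (4 * k + 1) = ε - 7 / 10 := if_neg (by simp [parity_simps])
    have e2 : crossBound ε (4 * k + 1 + 1) = 1 / 5 + 2 * ε := if_pos (by simp [parity_simps])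
    have e3 : crossBound ε (4 * k + 1 + 1 + 1) = ε - 7 / 10 := if_neg (by simp [parity_simps])
    have st1 := h0.succ hn hi hj (hX _) (hY _)
      (by rw [e0]; refine ⟨?_, ?_, ?_, ?_⟩ <;> linarith)
      (by rw [e0]; refine ⟨?_, ?_, ?_, ?_⟩ <;> linarith)
    have st2 := st1.succ hn hi hj (hX _) (hY _)
      (by rw [e1]; refine ⟨?_, ?_, ?_, ?_⟩ <;> linarith)
      (by rw [e1]; refine ⟨?_, ?_, ?_, ?_⟩ <;> linarith)
    have st3 := st2.succ hn hi hj (hX _) (hY _)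
      (by rw [e2]; refine ⟨?_, ?_, ?_, ?_⟩ <;> linarith)
      (by rw [e2]; refine ⟨?_, ?_, ?_, ?_⟩ <;> linarith)
    have st4 := st3.succ hn hi hj (hX _) (hY _)
      (by rw [e3]; refine ⟨?_, ?_, ?_, ?_⟩ <;> linarith)
      (by rw [e3]; refine ⟨?_, ?_, ?_, ?_⟩ <;> linarith)
    convert st4 using 1 <;> · push_cast; linarith

/-- Messages to the rows of the block are at least 9/10 - 1/20 from `j₂`, at most 7/10 + `ε` + 1/20
from `j₁`, and at most 1/5 + 2`ε` from elsewhere. Hence both rows choose `j₂`. -/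
theorem not_isEstimate_of_isMatching (hn : 2 ≤ n) (hi : i₁ ≠ i₂) (hj : j₁ ≠ j₂) (hε : 0 ≤ ε)
    (hε' : ε ≤ 1 / 26)
    (hX : ∀ t k j, k ≠ i₁ → k ≠ i₂ → (j = j₁ ∨ j = j₂) → (reduced w t).1 k j ≤ crossBound ε t)
    (hY : ∀ t k i, k ≠ j₁ → k ≠ j₂ → (i = i₁ ∨ i = i₂) → (reduced w t).2 k i ≤ crossBound ε t)
    (h₁₁ : w (i₁, j₁) ∈ Set.Icc (7 / 10) (7 / 10 + ε))
    (h₂₁ : w (i₂, j₁) ∈ Set.Icc (7 / 10) (7 / 10 + ε))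
    (h₁₂ : w (i₁, j₂) ∈ Set.Icc (9 / 10) (9 / 10 + ε))
    (h₂₂ : w (i₂, j₂) ∈ Set.Icc (9 / 10) (9 / 10 + ε)) (k : ℕ)
    (hk : (k : ℝ) * |blockGap w i₁ i₂ j₁ j₂| ≤ 1 / 20) {M : Finset (Edge n)}
    (hM : IsMatching M) : ¬ IsEstimate w (4 * k) M := by
  rintro ⟨f, hf, rfl⟩
  obtain ⟨-, y1, y2, y3, y4⟩ :=
    blockState_four_mul hn hi hj hε hε' hX hY h₁₁ h₂₁ h₁₂ h₂₂ k hk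
  have hb : |(k : ℝ) * blockGap w i₁ i₂ j₁ j₂| ≤ 1 / 20 := by rwa [abs_mul, Nat.abs_cast]
  obtain ⟨b1, b2⟩ := abs_le.mp hb
  have e0 : crossBound ε (4 * k) = 1 / 5 + 2 * ε := if_pos (by simp [parity_simps])
  have key : ∀ i, (i = i₁ ∨ i = i₂) → (reduced w (4 * k)).2 j₁ i < (reduced w (4 * k)).2 j₂ i →
      1 / 5 + 2 * ε < (reduced w (4 * k)).2 j₂ i → f i = j₂ := by
    intro i hi h1 h2
    have h := (belief_le_belief_iff hn w (4 * k) i j₂ (f i)).mp (hf i j₂)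
    by_contra hne
    by_cases h' : f i = j₁
    · rw [h'] at h; linarith
    · have := hY (4 * k) (f i) i h' hne hi
      linarith
  have f1 := key i₁ (.inl rfl) (by linarith [h₁₁.2, h₁₂.1]) (by linarith [h₁₂.1])
  have f2 := key i₂ (.inr rfl) (by linarith [h₂₁.2, h₂₂.1]) (by linarith [h₂₂.1])
  have := hM (i₁, f i₁) (Finset.mem_image_of_mem _ (Finset.mem_univ _)) (i₂, f i₂)
    (Finset.mem_image_of_mem _ (Finset.mem_univ _)) (.inr (by rw [f1, f2]))
  exact hi (congrArg Prod.fst this)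

end Block

/-! ### The block instance and its dual solution -/

variable {m : ℕ}

/-- The left end of the interval from which the weight of an edge is drawn; a vertex is given by
its block and by its place in the block. -/
def offset (x y : Fin m × Bool) : ℝ :=
  if x.1 = y.1 then (if y.2 then 9 / 10 else 7 / 10) else 0

/-- All weights lie in the intervals from which they are drawn. -/
def InRange (e : Fin m × Bool ≃ Fin n) (ε : ℝ) (w : Edge n → ℝ) : Prop :=
  ∀ i j, w (i, j) ∈ Set.Icc (offset (e.symm i) (e.symm j)) (offset (e.symm i) (e.symm j) + ε)

section Range

variable {e : Fin m × Bool ≃ Fin n} {ε : ℝ} {w : Edge n → ℝ}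

theorem InRange.mem_Icc (h : InRange e ε w) (x y : Fin m × Bool) :
    w (e x, e y) ∈ Set.Icc (offset x y) (offset x y + ε) := by
  simpa using h (e x) (e y)

/-- The dual variables of the columns. -/
def colDual (e : Fin m × Bool ≃ Fin n) (w : Edge n → ℝ) (y : Fin m × Bool) : ℝ :=
  if y.2 then w (e (y.1, false), e (y.1, true)) - w (e (y.1, false), e (y.1, false)) + 7 / 20
  else 7 / 20

/-- The dual variables of the rows. -/
def rowDual (e : Fin m × Bool ≃ Fin n) (w : Edge n → ℝ) (x : Fin m × Bool) : ℝ :=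
  max (w (e x, e (x.1, false)) - colDual e w (x.1, false))
    (w (e x, e (x.1, true)) - colDual e w (x.1, true))

/-- The optimal matching inside the blocks. -/
def blockPerm (e : Fin m × Bool ≃ Fin n) (w : Edge n → ℝ) : Equiv.Perm (Fin m × Bool) :=
  Function.Involutive.toPerm
    (fun x => if w (e (x.1, true), e (x.1, false)) - colDual e w (x.1, false) ≤
      w (e (x.1, true), e (x.1, true)) - colDual e w (x.1, true) then x else (x.1, !x.2))
    (fun x => by dsimp only; split_ifs <;> simp_all)

theorem blockPerm_apply (x : Fin m × Bool) : blockPerm e w x =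
    if w (e (x.1, true), e (x.1, false)) - colDual e w (x.1, false) ≤
      w (e (x.1, true), e (x.1, true)) - colDual e w (x.1, true) then x else (x.1, !x.2) := rfl

theorem blockPerm_fst (x : Fin m × Bool) : (blockPerm e w x).1 = x.1 := by
  rw [blockPerm_apply]; split_ifs <;> rfl

theorem InRange.colDual_mem (h : InRange e ε w) (hε : 0 ≤ ε) (hε' : ε ≤ 1 / 26)
    (y : Fin m × Bool) : colDual e w y ∈ Set.Icc (7 / 20) (11 / 20 + ε) := by
  obtain ⟨c, s⟩ := y
  have h1 := h.mem_Icc (c, false) (c, true)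
  have h2 := h.mem_Icc (c, false) (c, false)
  simp only [offset, if_true, Set.mem_Icc, Bool.false_eq_true, if_false] at h1 h2
  cases s <;> simp only [colDual, if_true, Set.mem_Icc, Bool.false_eq_true, if_false] <;>
    constructor <;> linarith

theorem InRange.rowDual_mem (h : InRange e ε w) (hε : 0 ≤ ε) (hε' : ε ≤ 1 / 26)
    (x : Fin m × Bool) : rowDual e w x ∈ Set.Icc (7 / 20) (11 / 20 + ε) := by
  obtain ⟨c, s⟩ := x
  have h1 := h.mem_Icc (c, false) (c, true)
  have h2 := h.mem_Icc (c, false) (c, false)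
  have h3 := h.mem_Icc (c, s) (c, true)
  have h4 := h.mem_Icc (c, s) (c, false)
  simp only [offset, if_true, Set.mem_Icc, Bool.false_eq_true, if_false] at h1 h2 h3 h4
  simp only [rowDual, colDual, if_true, Set.mem_Icc, Bool.false_eq_true, if_false]
  refine ⟨le_max_of_le_left (by linarith), max_le (by linarith) (by linarith)⟩

theorem InRange.le_rowDual_add_colDual (h : InRange e ε w) (hε : 0 ≤ ε) (hε' : ε ≤ 1 / 26)
    (x y : Fin m × Bool) : w (e x, e y) ≤ rowDual e w x + colDual e w y := by
  by_cases hxy : x.1 = y.1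
  · obtain ⟨c, s⟩ := y
    obtain rfl : x.1 = c := hxy
    have h1 := le_max_left (w (e x, e (x.1, false)) - colDual e w (x.1, false))
      (w (e x, e (x.1, true)) - colDual e w (x.1, true))
    have h2 := le_max_right (w (e x, e (x.1, false)) - colDual e w (x.1, false))
      (w (e x, e (x.1, true)) - colDual e w (x.1, true))
    rw [← rowDual] at h1 h2
    cases s <;> linarith
  · have h1 := h.mem_Icc x y
    rw [offset, if_neg hxy] at h1
    linarith [h1.2, (h.rowDual_mem hε hε' x).1, (h.colDual_mem hε hε' y).1]

/-- The column duals make the row `false` tight in both columns, so the row `true` may take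
whichever column attains its maximum and leave the other one. -/
theorem eq_rowDual_add_colDual (x : Fin m × Bool) :
    w (e x, e (blockPerm e w x)) = rowDual e w x + colDual e w (blockPerm e w x) := by
  obtain ⟨c, s⟩ := x
  rw [blockPerm_apply]
  cases s
  · split_ifs <;> simp [rowDual, colDual]
  · split_ifs with hc
    · simp only at hc
      simp only [rowDual]
      rw [max_eq_right hc]
      ring
    · simp only at hc
      simp only [rowDual, Bool.not_true]
      rw [max_eq_left (le_of_not_ge hc)]
      ring

theorem InRange.le_crossBound (h : InRange e ε w) (hn : 2 ≤ n) (hε : 0 ≤ ε) (hε' : ε ≤ 1 / 26)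
    {i j : Fin n} (hij : (e.symm i).1 ≠ (e.symm j).1) (t : ℕ) :
    (reduced w t).1 i j ≤ crossBound ε t ∧ (reduced w t).2 j i ≤ crossBound ε t := by
  refine crossBound_unmatched hn (a := fun i => rowDual e w (e.symm i))
    (b := fun j => colDual e w (e.symm j)) (π := e.symm.trans ((blockPerm e w).trans e)) hε
    (fun i j => ?_) (fun i => ?_) (fun i => h.rowDual_mem hε hε' _)
    (fun j => h.colDual_mem hε hε' _) (fun hj => hij ?_) ?_ t
  · simpa using h.le_rowDual_add_colDual hε hε' (e.symm i) (e.symm j)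
  · simpa using eq_rowDual_add_colDual (e := e) (w := w) (e.symm i)
  · rw [hj]
    simp [blockPerm_fst]
  · have := (h i j).2
    rwa [offset, if_neg hij, zero_add] at this

/-- The excess of the diagonal over the antidiagonal in the block `c`. -/
def gap (e : Fin m × Bool ≃ Fin n) (w : Edge n → ℝ) (c : Fin m) : ℝ :=
  blockGap w (e (c, false)) (e (c, true)) (e (c, false)) (e (c, true))

/-- Convergence by some `T < t` would make the estimate in iteration `4t` a matching. One unbalanced
choice in one block `c` refutes this. -/
theorem InRange.le_iterations (h : InRange e ε w) (hn : 2 ≤ n) (hε : 0 ≤ ε) (hε' : ε ≤ 1 / 26)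
    {c : Fin m} {t : ℕ} (ht : (t : ℝ) * |gap e w c| ≤ 1 / 20) : (t : ℕ∞) ≤ iterations w := by
  refine le_iInf₂ fun T ⟨M, hM, hT⟩ => ?_
  rw [Nat.cast_le]
  by_contra! hlt
  have hne : e (c, false) ≠ e (c, true) := by simp
  have hcross : ∀ k j : Fin n, k ≠ e (c, false) → k ≠ e (c, true) →
      (j = e (c, false) ∨ j = e (c, true)) → (e.symm k).1 ≠ (e.symm j).1 := by
    intro k j h1 h2 h3 h4
    have h5 : (e.symm j).1 = c := by rcases h3 with rfl | rfl <;> simp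
    obtain ⟨x, rfl⟩ := e.surjective k
    obtain ⟨d, s⟩ := x
    simp only [Equiv.symm_apply_apply] at h4
    cases s <;> simp_all
  have hp := h.mem_Icc (c, false) (c, false)
  have hq := h.mem_Icc (c, false) (c, true)
  have hr := h.mem_Icc (c, true) (c, false)
  have hs := h.mem_Icc (c, true) (c, true)
  simp only [offset, if_true, Bool.false_eq_true, if_false] at hp hq hr hs
  exact not_isEstimate_of_isMatching hn hne hne hε hε'
    (fun t k j h1 h2 h3 => (h.le_crossBound hn hε hε' (hcross k j h1 h2 h3) t).1)
    (fun t k i h1 h2 h3 => (h.le_crossBound hn hε hε' (hcross k i h1 h2 h3).symm t).2)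
    hp hr hq hs t ht hM.1 (hT (4 * t) (by omega))

end Range

/-! ### Uniform weights, independence and anti-concentration -/

/-- The uniform distribution on `[l, l + 1/φ]`. -/
def unif (φ l : ℝ) : Measure ℝ := ENNReal.ofReal φ • volume.restrict (Set.Icc l (l + φ⁻¹))

theorem unif_Icc {φ l x y : ℝ} (hφ : 0 ≤ φ) (hx : l ≤ x) (hy : y ≤ l + φ⁻¹) :
    unif φ l (Set.Icc x y) = ENNReal.ofReal (φ * (y - x)) := by
  rw [unif, Measure.smul_apply, Measure.restrict_apply measurableSet_Icc,
    Set.inter_eq_left.mpr (Set.Icc_subset_Icc hx hy), Real.volume_Icc, smul_eq_mul,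
    ENNReal.ofReal_mul hφ]

theorem unif_Icc_self {φ l : ℝ} (hφ : 0 < φ) : unif φ l (Set.Icc l (l + φ⁻¹)) = 1 := by
  rw [unif_Icc hφ.le le_rfl le_rfl, add_sub_cancel_left, mul_inv_cancel₀ hφ.ne',
    ENNReal.ofReal_one]

theorem isProbabilityMeasure_unif {φ l : ℝ} (hφ : 0 < φ) : IsProbabilityMeasure (unif φ l) := by
  refine ⟨?_⟩
  rw [← unif_Icc_self (l := l) hφ, unif, Measure.smul_apply, Measure.smul_apply,
    Measure.restrict_apply MeasurableSet.univ, Measure.restrict_apply measurableSet_Icc,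
    Set.univ_inter, Set.inter_self]

theorem hasBoundedDensity_unif {φ l : ℝ} (hφ : 0 < φ) (hl : 0 ≤ l) (hl' : l + φ⁻¹ ≤ 1) :
    HasBoundedDensity φ (unif φ l) := by
  refine ⟨isProbabilityMeasure_unif hφ, (Set.Icc l (l + φ⁻¹)).indicator fun _ => φ,
    measurable_const.indicator measurableSet_Icc, fun x => ?_, fun x hx => ?_, ?_⟩
  · by_cases h : x ∈ Set.Icc l (l + φ⁻¹)
    · rw [Set.indicator_of_mem h]; exact ⟨hφ.le, le_rfl⟩
    · rw [Set.indicator_of_notMem h]; exact ⟨le_rfl, hφ.le⟩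
  · exact Set.indicator_of_notMem (fun h => hx ⟨hl.trans h.1, h.2.trans hl'⟩) _
  · have : (fun x => ENNReal.ofReal ((Set.Icc l (l + φ⁻¹)).indicator (fun _ => φ) x)) =
        (Set.Icc l (l + φ⁻¹)).indicator (fun _ => ENNReal.ofReal φ) := by
      ext x
      by_cases h : x ∈ Set.Icc l (l + φ⁻¹) <;> simp [h]
    rw [this, withDensity_indicator measurableSet_Icc, withDensity_const, unif]

section Product

variable {ι : Type*}

/-- The σ-algebra generated by the coordinates in `S`. -/
abbrev coordAlgebra (S : Set ι) : MeasurableSpace (ι → ℝ) :=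
  ⨆ i ∈ S, MeasurableSpace.comap (fun w : ι → ℝ => w i) inferInstance

theorem measurable_coordAlgebra {S : Set ι} {i : ι} (hi : i ∈ S) :
    Measurable[coordAlgebra S] (fun w : ι → ℝ => w i) :=
  measurable_iff_comap_le.mpr
    (le_iSup₂ (f := fun (i : ι) (_ : i ∈ S) =>
      MeasurableSpace.comap (fun w : ι → ℝ => w i) inferInstance) i hi)

theorem coordAlgebra_mono {S T : Set ι} (h : S ⊆ T) : coordAlgebra S ≤ coordAlgebra T :=
  biSup_mono h

variable [Fintype ι] {D : ι → Measure ℝ} [∀ i, IsProbabilityMeasure (D i)]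

theorem iIndepFun_eval : ProbabilityTheory.iIndepFun (fun i (w : ι → ℝ) => w i) (Measure.pi D) :=
  ProbabilityTheory.iIndepFun_pi (X := fun _ x => x) fun _ => aemeasurable_id

theorem indep_coordAlgebra {S T : Set ι} (h : Disjoint S T) :
    ProbabilityTheory.Indep (coordAlgebra S) (coordAlgebra T) (Measure.pi D) :=
  ProbabilityTheory.indep_iSup_of_disjoint
    (fun i => measurable_iff_comap_le.mp (measurable_pi_apply i)) iIndepFun_eval h

theorem measure_biInter_eq_prod {κ : Type*} [DecidableEq κ] {E : κ → Set ι}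
    (hE : Pairwise fun c d => Disjoint (E c) (E d)) {B : κ → Set (ι → ℝ)}
    (hB : ∀ c, MeasurableSet[coordAlgebra (E c)] (B c)) (s : Finset κ) :
    Measure.pi D (⋂ c ∈ s, B c) = ∏ c ∈ s, Measure.pi D (B c) := by
  induction s using Finset.induction_on with
  | empty => simp
  | insert c s hc ih =>
    rw [Finset.prod_insert hc, ← ih, Finset.set_biInter_insert]
    have hd : Disjoint (E c) (⋃ d ∈ s, E d) := by
      rw [Set.disjoint_iUnion₂_right]
      exact fun d hd => hE fun h => hc (h ▸ hd)
    refine (ProbabilityTheory.Indep_iff _ _ _).mp (indep_coordAlgebra hd) _ _ (hB c) ?_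
    exact @Finset.measurableSet_biInter _ _ (coordAlgebra (⋃ d ∈ s, E d)) _ s fun d hd =>
      coordAlgebra_mono (Set.subset_biUnion_of_mem (u := E) hd) _ (hB d)

theorem measure_eval_mem (i : ι) {A : Set ℝ} (hA : MeasurableSet A) :
    Measure.pi D {w | w i ∈ A} = D i A :=
  (measurePreserving_eval D i).measure_preimage hA.nullMeasurableSet

/-- Given the other three weights, the gap is small iff `w p` is within `η` of `Z`. This has
probability `2φη` when `Z` is at distance at least `η` from the ends of the interval of `w p`, which
happens with probability at least 1/64. -/
theorem measure_abs_gap_le {φ η l₁ l₂ : ℝ} (hφ : 0 < φ) (hη : 0 ≤ η) (hη' : η ≤ φ⁻¹ / 8)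
    {p q r s : ι} (hpq : p ≠ q) (hpr : p ≠ r) (hps : p ≠ s) (hqr : q ≠ r) (hqs : q ≠ s)
    (hrs : r ≠ s) (hp : D p = unif φ l₁) (hr : D r = unif φ l₁) (hq : D q = unif φ l₂)
    (hs : D s = unif φ l₂) :
    ENNReal.ofReal (φ * η / 32) ≤
      Measure.pi D {w | |w p + w s - w q - w r| ≤ η} := by
  have hinv : 0 < φ⁻¹ := inv_pos.mpr hφ
  set Z : (ι → ℝ) → ℝ := fun w => w q + w r - w s with hZ
  have hZm : Measurable Z := by fun_prop
  have hpm : Measurable (fun w : ι → ℝ => w p) := measurable_pi_apply p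
  have hind : ProbabilityTheory.IndepFun (fun w : ι → ℝ => w p) Z (Measure.pi D) := by
    have hd : Disjoint ({p} : Set ι) {q, r, s} := by simp [hpq, hpr, hps]
    have h1 := measurable_coordAlgebra (S := {p}) (i := p) rfl
    have h2 : Measurable[coordAlgebra {q, r, s}] Z :=
      ((measurable_coordAlgebra (by simp)).add (measurable_coordAlgebra (by simp))).sub
        (measurable_coordAlgebra (by simp))
    exact ProbabilityTheory.indep_of_indep_of_le_left
      (ProbabilityTheory.indep_of_indep_of_le_right (indep_coordAlgebra hd)
        (measurable_iff_comap_le.mp h2)) (measurable_iff_comap_le.mp h1)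
  have hmap := (ProbabilityTheory.indepFun_iff_map_prod_eq_prod_map_map hpm.aemeasurable
    hZm.aemeasurable).mp hind
  have hA : MeasurableSet {x : ℝ × ℝ | |x.1 - x.2| ≤ η} :=
    measurableSet_le (by fun_prop) measurable_const
  have hset : {w : ι → ℝ | |w p + w s - w q - w r| ≤ η} =
      (fun w => (w p, Z w)) ⁻¹' {x : ℝ × ℝ | |x.1 - x.2| ≤ η} := by
    ext w
    simp only [Set.mem_ofPred_eq, Set.mem_preimage, hZ]
    rw [show w p + w s - w q - w r = w p - (w q + w r - w s) by ring]
  have hmapp : (Measure.pi D).map (fun w => w p) = unif φ l₁ := by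
    rw [← hp]; exact (measurePreserving_eval D p).map_eq
  rw [hset, ← Measure.map_apply (hpm.prodMk hZm) hA, hmap, hmapp]
  have := isProbabilityMeasure_unif (l := l₁) hφ
  have : IsProbabilityMeasure ((Measure.pi D).map Z) :=
    Measure.isProbabilityMeasure_map hZm.aemeasurable
  rw [Measure.prod_apply_symm hA]
  set S : Set ℝ := Set.Icc (l₁ + φ⁻¹ / 8) (l₁ + 7 / 8 * φ⁻¹) with hS
  have hslice : ∀ z ∈ S, ENNReal.ofReal (2 * (φ * η)) ≤
      unif φ l₁ ((fun x => (x, z)) ⁻¹' {x : ℝ × ℝ | |x.1 - x.2| ≤ η}) := by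
    intro z hz
    have : ((fun x => (x, z)) ⁻¹' {x : ℝ × ℝ | |x.1 - x.2| ≤ η}) = Set.Icc (z - η) (z + η) := by
      ext x
      simp only [Set.mem_preimage, Set.mem_ofPred_eq, abs_le, Set.mem_Icc]
      constructor <;> rintro ⟨h1, h2⟩ <;> constructor <;> linarith
    rw [this, unif_Icc hφ.le (by linarith [hz.1]) (by linarith [hz.2])]
    exact ENNReal.ofReal_le_ofReal (by linarith)
  have hZS : ENNReal.ofReal (1 / 64) ≤ (Measure.pi D).map Z S := by
    rw [Measure.map_apply hZm measurableSet_Icc]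
    -- If `q`, `r`, `s` all fall in the middle quarter of their intervals, then `Z` lies in `S`;
    -- this has probability `(1/4)^3`.
    classical
    let J : ι → Set ℝ := fun i => if i = r
      then Set.Icc (l₁ + 3 / 8 * φ⁻¹) (l₁ + 5 / 8 * φ⁻¹)
      else Set.Icc (l₂ + 3 / 8 * φ⁻¹) (l₂ + 5 / 8 * φ⁻¹)
    have hJ : ∀ i, MeasurableSet (J i) := fun i => by
      simp only [J]; split_ifs <;> exact measurableSet_Icc
    have hJr : J r = Set.Icc (l₁ + 3 / 8 * φ⁻¹) (l₁ + 5 / 8 * φ⁻¹) := if_pos rfl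
    have hJq : J q = Set.Icc (l₂ + 3 / 8 * φ⁻¹) (l₂ + 5 / 8 * φ⁻¹) := if_neg hqr
    have hJs : J s = Set.Icc (l₂ + 3 / 8 * φ⁻¹) (l₂ + 5 / 8 * φ⁻¹) := if_neg hrs.symm
    have hbox := (iIndepFun_eval (D := D)).measure_inter_preimage_eq_mul {q, r, s}
      (sets := J) (fun i _ => hJ i)
    have hquarter : ∀ l, unif φ l (Set.Icc (l + 3 / 8 * φ⁻¹) (l + 5 / 8 * φ⁻¹)) =
        ENNReal.ofReal (1 / 4) := by
      intro l
      rw [unif_Icc hφ.le (by linarith) (by linarith)]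
      congr 1
      field_simp
      norm_num
    rw [Finset.prod_insert (by simp [hqr, hqs]), Finset.prod_insert (by simp [hrs]),
      Finset.prod_singleton] at hbox
    have hv : ∀ i, Measure.pi D ((fun w : ι → ℝ => w i) ⁻¹' J i) = D i (J i) :=
      fun i => measure_eval_mem i (hJ i)
    rw [hv, hv, hv, hq, hr, hs, hJq, hJr, hJs, hquarter, hquarter,
      ← ENNReal.ofReal_mul (by norm_num), ← ENNReal.ofReal_mul (by norm_num)] at hbox
    rw [show (1 / 64 : ℝ) = 1 / 4 * (1 / 4 * (1 / 4)) by norm_num, ← hbox]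
    refine measure_mono fun w hw => ?_
    simp only [Finset.mem_insert, Finset.mem_singleton, Set.mem_iInter, Set.mem_preimage] at hw
    have hwq := hw q (by simp)
    have hwr := hw r (by simp)
    have hws := hw s (by simp)
    rw [hJq] at hwq
    rw [hJr] at hwr
    rw [hJs] at hws
    constructor <;> simp only [hZ] <;> linarith [hwq.1, hwq.2, hwr.1, hwr.2, hws.1, hws.2]
  calc ENNReal.ofReal (φ * η / 32)
      = ENNReal.ofReal (2 * (φ * η)) * ENNReal.ofReal (1 / 64) := by
        rw [← ENNReal.ofReal_mul (by positivity)]; congr 1; ring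
    _ ≤ ENNReal.ofReal (2 * (φ * η)) * (Measure.pi D).map Z S := by gcongr
    _ = ∫⁻ _ in S, ENNReal.ofReal (2 * (φ * η)) ∂(Measure.pi D).map Z := by
        rw [setLIntegral_const]
    _ ≤ ∫⁻ z in S, unif φ l₁ ((fun x => (x, z)) ⁻¹' {x : ℝ × ℝ | |x.1 - x.2| ≤ η})
          ∂(Measure.pi D).map Z := setLIntegral_mono' measurableSet_Icc hslice
    _ ≤ _ := setLIntegral_le_lintegral _ _

end Product

/-- With `y = m x` in `[0, 1]`: `(1 - x)^m ≤ exp (-y) ≤ 1 / (1 + y) ≤ 1 - y / 2`. -/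
theorem one_sub_pow_le {x : ℝ} {m : ℕ} (hx : 0 ≤ x) (hx' : m * x ≤ 1) (hx1 : x ≤ 1) :
    (1 - x) ^ m ≤ 1 - m * x / 2 := by
  have hy : 0 ≤ m * x := by positivity
  have h1 : (1 - x) ^ m ≤ Real.exp (-(m * x)) := by
    rw [show -(m * x) = m * (-x) by ring, Real.exp_nat_mul]
    exact pow_le_pow_left₀ (by linarith) (Real.one_sub_le_exp_neg x) m
  refine h1.trans ?_
  rw [Real.exp_neg]
  have h2 := Real.add_one_le_exp (m * x)
  rw [inv_le_comm₀ (Real.exp_pos _) (by linarith)]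
  refine le_trans ?_ h2
  rw [inv_le_iff_one_le_mul₀ (by linarith)]
  nlinarith

/-! ### Probability of a nearly balanced block and infinite expectation -/

section Main

variable {e : Fin m × Bool ≃ Fin n} {φ : ℝ}

/-- The distribution of the weight of an edge. -/
def edgeDist (e : Fin m × Bool ≃ Fin n) (φ : ℝ) (f : Edge n) : Measure ℝ :=
  unif φ (offset (e.symm f.1) (e.symm f.2))

theorem hasBoundedDensity_edgeDist (hφ : 26 ≤ φ) (f : Edge n) :
    HasBoundedDensity φ (edgeDist e φ f) := by
  have h : φ⁻¹ ≤ 1 / 26 := by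
    rw [one_div]; exact inv_anti₀ (by norm_num) hφ
  refine hasBoundedDensity_unif (by linarith) ?_ ?_ <;> rw [offset] <;> split_ifs <;> linarith

theorem ae_inRange (hφ : 26 ≤ φ) :
    ∀ᵐ w ∂(Measure.pi (edgeDist e φ)), InRange e φ⁻¹ w := by
  have := fun f => (hasBoundedDensity_edgeDist (e := e) hφ f).1
  simp only [InRange, ae_all_iff]
  intro i j
  have h : ∀ᵐ x ∂(edgeDist e φ (i, j)),
      x ∈ Set.Icc (offset (e.symm i) (e.symm j)) (offset (e.symm i) (e.symm j) + φ⁻¹) := by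
    exact Filter.eventually_of_mem ((mem_ae_iff_prob_eq_one measurableSet_Icc).mpr
      (unif_Icc_self (by linarith))) fun _ => id
  exact (Measure.tendsto_eval_ae_ae (μ := edgeDist e φ) (i := (i, j))).eventually h

/-- Some block is nearly balanced: the event that causes slow convergence. -/
def slowEvent (e : Fin m × Bool ≃ Fin n) (η : ℝ) : Set (Edge n → ℝ) :=
  {w | ∃ c, |gap e w c| ≤ η}

theorem measurable_gap (c : Fin m) : Measurable (fun w => gap e w c) := by
  unfold gap blockGap
  fun_prop

theorem measurableSet_slowEvent (η : ℝ) : MeasurableSet (slowEvent e η) := by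
  rw [slowEvent, Set.ofPred_exists]
  exact MeasurableSet.iUnion fun c =>
    measurableSet_le (continuous_abs.measurable.comp (measurable_gap c)) measurable_const

theorem le_measure_slowEvent (hφ : 26 ≤ φ) {η : ℝ} (hη : 0 ≤ η) (hη' : η ≤ φ⁻¹ / 8)
    (hm : m * (φ * η / 32) ≤ 1) :
    ENNReal.ofReal (m * (φ * η / 32) / 2) ≤ Measure.pi (edgeDist e φ) (slowEvent e η) := by
  have := fun f => (hasBoundedDensity_edgeDist (e := e) hφ f).1
  have hφ0 : 0 < φ := by linarith
  set μ := Measure.pi (edgeDist e φ) with hμ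
  set x := φ * η / 32 with hx
  have hx0 : 0 ≤ x := by positivity
  have hx1 : x ≤ 1 := by
    have : φ * η ≤ φ * (φ⁻¹ / 8) := by gcongr
    rw [← mul_div_assoc, mul_inv_cancel₀ hφ0.ne'] at this
    linarith
  have hblock : ∀ c, μ {w | η < |gap e w c|} ≤ ENNReal.ofReal (1 - x) := by
    intro c
    have hm : MeasurableSet {w | |gap e w c| ≤ η} :=
      measurableSet_le (continuous_abs.measurable.comp (measurable_gap c)) measurable_const
    have h : ENNReal.ofReal x ≤ μ {w | |gap e w c| ≤ η} := by
      refine measure_abs_gap_le (D := edgeDist e φ) (l₁ := 7 / 10) (l₂ := 9 / 10) hφ0 hη hη'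
        (p := (e (c, false), e (c, false))) (q := (e (c, false), e (c, true)))
        (r := (e (c, true), e (c, false))) (s := (e (c, true), e (c, true)))
        ?_ ?_ ?_ ?_ ?_ ?_ ?_ ?_ ?_ ?_ <;> simp [edgeDist, offset]
    have hc : {w | η < |gap e w c|} = {w | |gap e w c| ≤ η}ᶜ := by
      ext w; simp
    rw [hc, prob_compl_eq_one_sub hm, ENNReal.ofReal_sub _ hx0, ENNReal.ofReal_one]
    gcongr
  have hcompl : (slowEvent e η)ᶜ = ⋂ c ∈ Finset.univ, {w | η < |gap e w c|} := by
    ext w; simp [slowEvent]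
  have hprod : μ (slowEvent e η)ᶜ ≤ ENNReal.ofReal (1 - m * x / 2) := by
    rw [hcompl, hμ, measure_biInter_eq_prod
      -- Grouping edges by the block of their row gives disjoint sets, each containing the four
      -- edges that determine the gap of its block.
      (E := fun c => {f : Edge n | (e.symm f.1).1 = c})]
    · calc ∏ c : Fin m, μ {w | η < |gap e w c|}
          ≤ ∏ _c : Fin m, ENNReal.ofReal (1 - x) := Finset.prod_le_prod' fun c _ => hblock c
        _ = ENNReal.ofReal ((1 - x) ^ m) := by
          rw [Finset.prod_const, Finset.card_univ, Fintype.card_fin,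
            ENNReal.ofReal_pow (by linarith)]
        _ ≤ _ := ENNReal.ofReal_le_ofReal (one_sub_pow_le hx0 hm hx1)
    · intro c d hcd
      rw [Set.disjoint_left]
      exact fun f hf hf' => hcd (hf.symm.trans hf')
    · intro c
      have hg : Measurable[coordAlgebra {f : Edge n | (e.symm f.1).1 = c}]
          (fun w => gap e w c) :=
        (((measurable_coordAlgebra (by simp)).add (measurable_coordAlgebra (by simp))).sub
          (measurable_coordAlgebra (by simp))).sub (measurable_coordAlgebra (by simp))
      exact (continuous_abs.measurable.comp hg) measurableSet_Ioi
  have hmx : 0 ≤ m * x / 2 := by positivity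
  have h1 := prob_compl_eq_one_sub (μ := μ) (measurableSet_slowEvent (e := e) η).compl
  rw [compl_compl] at h1
  rw [h1]
  calc ENNReal.ofReal (m * x / 2) = 1 - ENNReal.ofReal (1 - m * x / 2) := by
        rw [← ENNReal.ofReal_one, ← ENNReal.ofReal_sub _ (by linarith)]; congr 1; ring
    _ ≤ _ := tsub_le_tsub_left hprod 1

theorem le_iterations_of_mem_slowEvent (hn : 2 ≤ n) (hφ : 26 ≤ φ) {w : Edge n → ℝ}
    (hw : InRange e φ⁻¹ w) {t : ℕ} (ht : 0 < t) (h : w ∈ slowEvent e (1 / (20 * t))) :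
    (t : ℕ∞) ≤ iterations w := by
  obtain ⟨c, hc⟩ := h
  have hφ0 : 0 ≤ φ⁻¹ := inv_nonneg.mpr (by linarith)
  have hφ' : φ⁻¹ ≤ 1 / 26 := by
    rw [one_div]; exact inv_anti₀ (by norm_num) hφ
  refine hw.le_iterations hn hφ0 hφ' (c := c) ?_
  have ht' : (0 : ℝ) < t := by exact_mod_cast ht
  calc (t : ℝ) * |gap e w c| ≤ t * (1 / (20 * t)) := by gcongr
    _ = 1 / 20 := by field_simp

/-- The constant is `2560 = 2 · 20 · 32 · 2`: from `m = n/2`, `η = 1/(20t)`, the anti-concentration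
bound and `one_sub_pow_le`. -/
theorem slowEvent_probability (hnm : n = 2 * m) (hφ : 26 ≤ φ) (hn : 2 ≤ n) {t : ℕ}
    (ht : (n : ℝ) * φ ≤ t) :
    ENNReal.ofReal (1 / 2560 * ((n : ℝ) * φ / t)) ≤
      Measure.pi (edgeDist e φ) (slowEvent e (1 / (20 * t))) := by
  have hn' : (2 : ℝ) ≤ n := by exact_mod_cast hn
  have hnm' : (n : ℝ) = 2 * m := by exact_mod_cast hnm
  have hφ0 : 0 < φ := by linarith
  have ht0 : (0 : ℝ) < t := lt_of_lt_of_le (by positivity) ht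
  have hφt : 2 * φ ≤ t := le_trans (by gcongr) ht
  have hx : (m : ℝ) * (φ * (1 / (20 * t)) / 32) / 2 = 1 / 2560 * ((n : ℝ) * φ / t) := by
    rw [hnm']; field_simp; ring
  rw [← hx]
  refine le_measure_slowEvent hφ (by positivity) ?_ ?_
  · rw [div_le_div_iff₀ (by positivity) (by norm_num), inv_mul_eq_div, le_div_iff₀ hφ0]
    linarith
  · have : (n : ℝ) * φ / t ≤ 1 := (div_le_one ht0).mpr ht
    linarith

theorem tsum_indicator_le (N : ℕ∞) {p : ℕ → Prop} [DecidablePred p]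
    (h : ∀ t, p t → ((t + 1 : ℕ) : ℕ∞) ≤ N) :
    ∑' t, (if p t then 1 else 0 : ENNReal) ≤ (N : ENNReal) := by
  induction N using ENat.recTopCoe with
  | top => simp
  | coe N =>
    rw [tsum_eq_sum (s := Finset.range N)]
    · calc ∑ t ∈ Finset.range N, (if p t then 1 else 0 : ENNReal)
          ≤ ∑ _t ∈ Finset.range N, 1 := Finset.sum_le_sum fun t _ => by split_ifs <;> simp
        _ = _ := by simp
    · intro t ht
      refine if_neg fun hp => ht ?_
      have := h t hp
      rw [Nat.cast_le] at this
      exact Finset.mem_range.mpr this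

theorem lintegral_iterations_eq_top (hnm : n = 2 * m) (hφ : 26 ≤ φ) (hn : 2 ≤ n) :
    ∫⁻ w : Edge n → ℝ, (iterations w : ENNReal) ∂(Measure.pi (edgeDist e φ)) = ⊤ := by
  have := fun f => (hasBoundedDensity_edgeDist (e := e) hφ f).1
  classical
  have hn' : (2 : ℝ) ≤ n := by exact_mod_cast hn
  have hnφ : 0 < (n : ℝ) * φ := mul_pos (by linarith) (by linarith)
  set E : ℕ → Set (Edge n → ℝ) := fun t => slowEvent e (1 / (20 * ((t + 1 : ℕ) : ℝ))) with hE
  have h1 : ∫⁻ w, ∑' t, (if w ∈ E t then 1 else 0 : ENNReal) ∂(Measure.pi (edgeDist e φ)) ≤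
      ∫⁻ w, (iterations w : ENNReal) ∂(Measure.pi (edgeDist e φ)) := by
    refine lintegral_mono_ae ?_
    filter_upwards [ae_inRange hφ] with w hw
    exact tsum_indicator_le _ fun t ht => le_iterations_of_mem_slowEvent hn hφ hw t.succ_pos ht
  have hmeas : ∀ t, MeasurableSet (E t) := fun t => measurableSet_slowEvent _
  have hmeas' : ∀ t, Measurable fun w => (if w ∈ E t then 1 else 0 : ENNReal) := fun t =>
    Measurable.ite (hmeas t) measurable_const measurable_const
  rw [lintegral_tsum fun t => (hmeas' t).aemeasurable] at h1
  have h2 : ∀ t, ∫⁻ w, (if w ∈ E t then 1 else 0 : ENNReal) ∂(Measure.pi (edgeDist e φ)) =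
      Measure.pi (edgeDist e φ) (E t) := fun t => by
    rw [← lintegral_indicator_one (hmeas t)]
    rfl
  simp_rw [h2] at h1
  rw [eq_top_iff]
  refine le_trans ?_ h1
  obtain ⟨K, hK⟩ := exists_nat_ge ((n : ℝ) * φ)
  -- The probability bound needs times of at least `nφ`, so the series starts at `K + 1`; a tail of
  -- the harmonic series still diverges.
  set g : ℕ → ℝ := fun t => 1 / 2560 * ((n : ℝ) * φ / ((t + (K + 1) : ℕ) : ℝ)) with hg
  have hdiv : ¬ Summable g := by
    intro hs
    have h3 : Summable fun t : ℕ => 1 / ((t + (K + 1) : ℕ) : ℝ) := by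
      refine (hs.mul_left (2560 / ((n : ℝ) * φ))).congr fun t => ?_
      simp only [hg]
      field_simp
    exact Real.not_summable_one_div_natCast
      ((summable_nat_add_iff (f := fun t : ℕ => 1 / (t : ℝ)) (K + 1)).mp h3)
  have hg0 : ∀ t, 0 ≤ g t := fun t => by positivity
  have h4 : ∑' t, ENNReal.ofReal (g t) = ⊤ := by
    by_contra hne
    refine hdiv ?_
    have := ENNReal.summable_toReal hne
    simpa only [ENNReal.toReal_ofReal (hg0 _)] using this
  rw [← h4]
  calc ∑' t, ENNReal.ofReal (g t)
      ≤ ∑' t, Measure.pi (edgeDist e φ) (E (t + K)) := by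
        refine ENNReal.tsum_le_tsum fun t => ?_
        refine slowEvent_probability hnm hφ hn (t := t + (K + 1)) (hK.trans ?_)
        push_cast
        linarith [(Nat.cast_nonneg t : (0 : ℝ) ≤ t)]
    _ ≤ ∑' t, Measure.pi (edgeDist e φ) (E t) :=
        ENNReal.tsum_comp_le_tsum_of_injective (add_left_injective K) _

end Main

end

end BPMatching

theorem mainTheorem5 :
    ∃ a c : ℝ, 0 < a ∧ 0 < c ∧
      ∀ (φ : ℝ) (n : ℕ), 26 ≤ φ → 2 ≤ n → Even n →
        ∃ D : BPMatching.Edge n → MeasureTheory.Measure ℝ,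
          (∀ e, BPMatching.HasBoundedDensity φ (D e)) ∧
          (∀ t : ℕ, (n : ℝ) * φ / c ≤ (t : ℝ) →
            ENNReal.ofReal (a * ((n : ℝ) * φ / (t : ℝ))) ≤
              MeasureTheory.Measure.pi D
                {w : BPMatching.Edge n → ℝ | (t : ℕ∞) ≤ BPMatching.iterations w}) ∧
          ∫⁻ w : BPMatching.Edge n → ℝ, (BPMatching.iterations w : ENNReal)
            ∂(MeasureTheory.Measure.pi D) = ⊤ := by
  refine ⟨1 / 2560, 1, by norm_num, one_pos, fun φ n hφ hn hev => ?_⟩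
  obtain ⟨m, hm⟩ := even_iff_exists_two_mul.mp hev
  have e : Fin m × Bool ≃ Fin n := Fintype.equivFinOfCardEq (by simp [hm, mul_comm])
  refine ⟨BPMatching.edgeDist e φ, BPMatching.hasBoundedDensity_edgeDist hφ, fun t ht => ?_,
    BPMatching.lintegral_iterations_eq_top hm hφ hn⟩
  rw [div_one] at ht
  -- The inclusion holds only up to the null set where some weight leaves its interval; no
  -- measurability of the target event is needed.
  refine (BPMatching.slowEvent_probability (e := e) hm hφ hn ht).trans (measure_mono_ae ?_)
  filter_upwards [BPMatching.ae_inRange hφ] with w hw hslow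
  have hn' : (2 : ℝ) ≤ n := by exact_mod_cast hn
  have ht0 : (0 : ℝ) < t := lt_of_lt_of_le (mul_pos (by linarith) (by linarith)) ht
  exact BPMatching.le_iterations_of_mem_slowEvent hn hφ hw (by exact_mod_cast ht0) hslow
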